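/- Let $(\Omega,\mu)$ be a $\sigma$-finite, non-atomic measure space. All functions are measurable scalar (real or complex) functions on $\Omega$, identified when equal $\mu$-a.e.; $f^*(t)=\inf\{s\ge 0:\mu\{|f|>s\}\le t\}$, $t>0$, is the non-increasing rearrangement of $f$, and $\|\cdot\|_{q,(c,d)}$ is the usual (quasi-)norm of $L_q$ on the interval $(c,d)$, with $1/\infty=0$ and $1/0=\infty$. Let $SV$ be the set of positive Lebesgue measurable functions $b$ on $(0,\infty)$ such that, for each $\varepsilon>0$, $t^{\varepsilon}b(t)$ is equivalent (up to positive constant factors) to a non-decreasing function and $t^{-\varepsilon}b(t)$ is equivalent to a non-increasing function. For two quasi-normed spaces $A_0,A_1$ of such functions, $0<\theta\le 1$, $0<q,r\le\infty$ and $a,b\in SV$, let $(A_0,A_1)^{\mathcal R}_{\theta,r,b,q,a}$ be the space of all $f\in A_0+A_1$ with $$\Big\|t^{-\frac1r}b(t)\,\big\|u^{-\theta-\frac1q}a(u)K(u,f)\big\|_{q,(t,\infty)}\Big\|_{r,(0,\infty)}<\infty,$$ $$K(u,f)=\inf\{\|f_0\|_{A_0}+u\|f_1\|_{A_1}: f=f_0+f_1,\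 f_i\in A_i\}.$$ For $0<p,q,r\le\infty$ and $a,b\in SV$, let $L^{\mathcal R}_{p,r,b,q,a}$ be the space of all $f$ with $$\Big\|t^{-\frac1r}b(t)\,\big\|u^{\frac1p-\frac1q}a(u)f^*(u)\big\|_{q,(t,\infty)}\Big\|_{r,(0,\infty)}<\infty,$$ and let the grand Lorentz–Karamata space $L^{p),q,r}_b$ be the space of all $f$ with $$\Big\|t^{-\frac1r}b(t)\,\big\|u^{\frac1p-\frac1q}f^*(u)\big\|_{q,(t,\infty)}\Big\|_{r,(0,\infty)}<\infty;$$ each of these spaces is quasi-normed by the displayed expression. Let $L_{\kappa,\infty}$ be the weak $L_\kappa$ space, quasi-normed by $\sup_{t>0}t^{1/\kappa}f^*(t)$. Equality of spaces means equality as sets with equivalent quasi-norms. **Theorem.** Let $0<\theta\le1$, $0<\kappa<\infty$, $p=\frac{\kappa}{1-\theta}$ (so $p=\infty$ if $\theta=1$), $0<q,r\le\infty$ and $a,b\in SV$. Put $\dddot a(t)=a(t^{1/\kappa})$ and $\dddot b(t)=b(t^{1/\kappa})$ for $t>0$. Then $$(L_\kappa,L_\infty)^{\mathcal R}_{\theta,r,b,q,a}=(L_{\kappa,\infty},L_\infty)^{\mathcal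 R}_{\theta,r,b,q,a}=L^{\mathcal R}_{p,r,\dddot b,q,\dddot a}.$$ In particular, for $a\equiv 1$, $$(L_\kappa,L_\infty)^{\mathcal R}_{\theta,r,b,q,1}=(L_{\kappa,\infty},L_\infty)^{\mathcal R}_{\theta,r,b,q,1}=L^{p),q,r}_{\dddot b}.$$ -/

import Mathlib

open MeasureTheory Set
open scoped ENNReal NNReal

/-- `μ` is non-atomic: every measurable set of positive measure has a measurable subset of
strictly smaller positive measure. -/
def IsNonatomicMeasure {Ω : Type*} [MeasurableSpace Ω] (μ : Measure Ω) : Prop :=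
  ∀ A : Set Ω, MeasurableSet A → 0 < μ A → ∃ B ⊆ A, MeasurableSet B ∧ 0 < μ B ∧ μ B < μ A

/-- `b ∈ SV`: `b` is positive and Lebesgue measurable on `(0, ∞)` and, for each `ε > 0`,
`t ^ ε * b t` is equivalent to a non-decreasing function and `t ^ (-ε) * b t` is equivalent to
a non-increasing function. Only the values of `b` on `(0, ∞)` matter. -/
structure IsSlowlyVarying (b : ℝ → ℝ) : Prop where
  pos : ∀ t : ℝ, 0 < t → 0 < b t
  aemeasurable : AEMeasurable b (volume.restrict (Ioi 0))
  equiv_increasing : ∀ ε : ℝ, 0 < ε → ∃ g : ℝ → ℝ, MonotoneOn g (Ioi 0) ∧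
    ∃ c C : ℝ, 0 < c ∧ 0 < C ∧ ∀ t : ℝ, 0 < t → c * g t ≤ t ^ ε * b t ∧ t ^ ε * b t ≤ C * g t
  equiv_decreasing : ∀ ε : ℝ, 0 < ε → ∃ g : ℝ → ℝ, AntitoneOn g (Ioi 0) ∧
    ∃ c C : ℝ, 0 < c ∧ 0 < C ∧
      ∀ t : ℝ, 0 < t → c * g t ≤ t ^ (-ε) * b t ∧ t ^ (-ε) * b t ≤ C * g t

/-- The weighted quasi-norm `‖ t ^ (σ - 1/q) a(t) φ(t) ‖_{q, s}` over a set `s` of positive reals,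
for a function `φ` with values in `[0, ∞]`, with the convention `1/∞ = 0`. -/
noncomputable def weightedNorm (σ : ℝ) (q : ℝ≥0∞) (a : ℝ → ℝ) (φ : ℝ → ℝ≥0∞) (s : Set ℝ) : ℝ≥0∞ :=
  eLpNorm (fun t : ℝ => ENNReal.ofReal (t ^ (σ - (1 / q).toReal) * a t) * φ t) q
    (volume.restrict s)

/-- The iterated quasi-norm
`‖ t ^ (-1/r) b(t) ‖ u ^ (σ - 1/q) a(u) φ(u) ‖_{q, (t, ∞)} ‖_{r, (0, ∞)}`. -/
noncomputable def rNorm (σ : ℝ) (r : ℝ≥0∞) (b : ℝ → ℝ) (q : ℝ≥0∞) (a : ℝ → ℝ)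
    (φ : ℝ → ℝ≥0∞) : ℝ≥0∞ :=
  weightedNorm 0 r b (fun t : ℝ => weightedNorm σ q a φ (Ioi t)) (Ioi 0)

section FunctionSpaces

variable {Ω : Type*} [MeasurableSpace Ω]

/-- A space of (classes of) measurable functions on `Ω` together with the functional that serves
as its quasi-norm. -/
structure FunctionSpace (μ : Measure Ω) (𝕜 : Type*) [RCLike 𝕜] where
  carrier : Set (Ω →ₘ[μ] 𝕜)
  qnorm : (Ω →ₘ[μ] 𝕜) → ℝ≥0∞

variable {μ : Measure Ω} {𝕜 : Type*} [RCLike 𝕜]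

/-- The space of all measurable `f` with `N f < ∞`, quasi-normed by `N`. -/
def FunctionSpace.ofQNorm (N : (Ω →ₘ[μ] 𝕜) → ℝ≥0∞) : FunctionSpace μ 𝕜 where
  carrier := {f | N f < ∞}
  qnorm := N

/-- Continuous embedding: `X ⊆ Y` and `‖f‖_Y ≤ C ‖f‖_X` for all `f ∈ X`. -/
def FunctionSpace.Embeds (X Y : FunctionSpace μ 𝕜) : Prop :=
  X.carrier ⊆ Y.carrier ∧ ∃ C : ℝ≥0, ∀ f ∈ X.carrier, Y.qnorm f ≤ C * X.qnorm f

/-- Equality of quasi-normed spaces: the same elements, with equivalent quasi-norms. -/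
def FunctionSpace.Equal (X Y : FunctionSpace μ 𝕜) : Prop :=
  X.Embeds Y ∧ Y.Embeds X

/-- The non-increasing rearrangement `f^*(t) = inf {s ≥ 0 : μ {|f| > s} ≤ t}`, `t > 0`. -/
noncomputable def rearrangement (f : Ω →ₘ[μ] 𝕜) (t : ℝ) : ℝ≥0∞ :=
  sInf {s : ℝ≥0∞ | μ {x | s < ‖f x‖ₑ} ≤ ENNReal.ofReal t}

variable (μ 𝕜)

/-- The Lebesgue space `L_p`, `0 < p ≤ ∞`. -/
noncomputable def lebesgueSpace (p : ℝ≥0∞) : FunctionSpace μ 𝕜 :=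
  .ofQNorm fun f => eLpNorm f p μ

/-- The Lorentz-Karamata space `L_{p,q;a}`, with quasi-norm
`‖ t ^ (1/p - 1/q) a(t) f^*(t) ‖_{q, (0, ∞)}`. -/
noncomputable def lorentzKaramataSpace (p q : ℝ≥0∞) (a : ℝ → ℝ) : FunctionSpace μ 𝕜 :=
  .ofQNorm fun f => weightedNorm (1 / p).toReal q a (rearrangement f) (Ioi 0)

/-- The Lorentz space `L_{p,q}`; for `q = ∞` it is weak `L_p`. -/
noncomputable def lorentzSpace (p q : ℝ≥0∞) : FunctionSpace μ 𝕜 :=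
  lorentzKaramataSpace μ 𝕜 p q fun _ => 1

/-- The `𝓡` Lorentz-Karamata space `L^𝓡_{p,r,b,q,a}`, with quasi-norm
`‖ t ^ (-1/r) b(t) ‖ u ^ (1/p - 1/q) a(u) f^*(u) ‖_{q, (t, ∞)} ‖_{r, (0, ∞)}`. -/
noncomputable def rLorentzKaramataSpace (p r : ℝ≥0∞) (b : ℝ → ℝ) (q : ℝ≥0∞) (a : ℝ → ℝ) :
    FunctionSpace μ 𝕜 :=
  .ofQNorm fun f => rNorm (1 / p).toReal r b q a (rearrangement f)

/-- The grand Lorentz-Karamata space `L^{p),q,r}_b`, with quasi-norm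
`‖ t ^ (-1/r) b(t) ‖ u ^ (1/p - 1/q) f^*(u) ‖_{q, (t, ∞)} ‖_{r, (0, ∞)}`. -/
noncomputable def grandLorentzKaramataSpace (p q r : ℝ≥0∞) (b : ℝ → ℝ) : FunctionSpace μ 𝕜 :=
  .ofQNorm fun f =>
    eLpNorm (fun t : ℝ => ENNReal.ofReal (t ^ (-(1 / r).toReal) * b t) *
        eLpNorm (fun u : ℝ =>
            ENNReal.ofReal (u ^ ((1 / p).toReal - (1 / q).toReal)) * rearrangement f u)
          q (volume.restrict (Ioi t)))
      r (volume.restrict (Ioi 0))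

variable {μ 𝕜}

/-- The algebraic sum `A₀ + A₁`. -/
def sumCarrier (A₀ A₁ : FunctionSpace μ 𝕜) : Set (Ω →ₘ[μ] 𝕜) :=
  {f | ∃ f₀ ∈ A₀.carrier, ∃ f₁ ∈ A₁.carrier, f = f₀ + f₁}

/-- Peetre's functional
`K(t, f; A₀, A₁) = inf {‖f₀‖_{A₀} + t ‖f₁‖_{A₁} : f = f₀ + f₁, f₀ ∈ A₀, f₁ ∈ A₁}`. -/
noncomputable def peetreK (A₀ A₁ : FunctionSpace μ 𝕜) (f : Ω →ₘ[μ] 𝕜) (t : ℝ) : ℝ≥0∞ :=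
  sInf {k : ℝ≥0∞ | ∃ f₀ ∈ A₀.carrier, ∃ f₁ ∈ A₁.carrier, f = f₀ + f₁ ∧
    k = A₀.qnorm f₀ + ENNReal.ofReal t * A₁.qnorm f₁}

/-- The `𝓡` limiting interpolation space `(A₀, A₁)^𝓡_{θ,r,b,q,a}`: all `f ∈ A₀ + A₁` with
`‖ t ^ (-1/r) b(t) ‖ u ^ (-θ - 1/q) a(u) K(u, f) ‖_{q, (t, ∞)} ‖_{r, (0, ∞)} < ∞`. -/
noncomputable def rInterpolationSpace (A₀ A₁ : FunctionSpace μ 𝕜) (θ : ℝ) (r : ℝ≥0∞)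
    (b : ℝ → ℝ) (q : ℝ≥0∞) (a : ℝ → ℝ) : FunctionSpace μ 𝕜 where
  carrier := {f | f ∈ sumCarrier A₀ A₁ ∧ rNorm (-θ) r b q a (peetreK A₀ A₁ f) < ∞}
  qnorm f := rNorm (-θ) r b q a (peetreK A₀ A₁ f)

end FunctionSpaces

/-! The substitution `u = e ^ x` turns the quasi-norms into iterated norms `tailNorm` on the line,
and dilations of `f^*` into translations. A slowly varying weight grows by at most `C e^{εh}` when
`x` increases by `h`, with `ε` as small as desired. The space `L_κ` embeds in weak `L_κ`, so the
`K`-functional of the weak pair is the smaller one. It remains to bound that one from below, and the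
one of `(L_κ, L_∞)` from above, by `f^*`.

The lower bound `K(t, f) ≥ e⁻¹ t f^*(t^κ)` is `mul_rearrangement_le_peetreK`. For the upper bound,
cut `f` at height `f^*(t^κ)` and sum over level sets. For every `η < 1/κ` this gives `K(t, f) ≤ C
sup_k t e^{-ηk} f^*(e^{-k} t^κ)`, which is `exists_peetreK_lebesgueSpace_le`. A supremum in place of
the usual integral of `f^*` avoids Hardy and triangle inequalities, so that `q, r < 1` need no
separate treatment.

The `k`-th term is a translate by `k/κ`. By `exists_tailNorm_dilation_le` its norm costs little more
than `e^{(1-θ)k/κ}`. Since `θ > 0`, `η` fits strictly between `(1-θ)/κ` and `1/κ`; the norms then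
decay geometrically, and `exists_tailNorm_iSup_le` bounds the norm of the supremum. The case `θ = 1`
is not special. -/

/-- Constants can be pulled out of the `L_q` quasi-norm of a `[0, ∞]`-valued function. -/
theorem eLpNorm_ennreal_const_mul {α : Type*} [MeasurableSpace α] {μ : Measure α} {c : ℝ≥0∞}
    (hc0 : c ≠ 0) (hc : c ≠ ∞) (f : α → ℝ≥0∞) (q : ℝ≥0∞) :
    eLpNorm (fun x => c * f x) q μ = c * eLpNorm f q μ := by
  have key : ∀ (d : ℝ≥0) (g : α → ℝ≥0∞),
      eLpNorm (fun x => (d : ℝ≥0∞) * g x) q μ ≤ d * eLpNorm g q μ := fun d g =>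
    eLpNorm_le_mul_eLpNorm_of_ae_le_mul' (c := d)
      (Filter.Eventually.of_forall fun x => by simp) q
  lift c to ℝ≥0 using hc
  have hc' : c ≠ 0 := by simpa using hc0
  refine le_antisymm (key c f) ?_
  -- The reverse inequality is the same one applied to `c⁻¹` and `c * f`.
  have h := key c⁻¹ (fun x => (c : ℝ≥0∞) * f x)
  rw [ENNReal.coe_inv hc'] at h
  have h2 : (fun x => (c : ℝ≥0∞)⁻¹ * ((c : ℝ≥0∞) * f x)) = f := by
    funext x
    rw [← mul_assoc, ENNReal.inv_mul_cancel hc0 ENNReal.coe_ne_top, one_mul]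
  rw [h2] at h
  calc (c : ℝ≥0∞) * eLpNorm f q μ
      ≤ c * ((c : ℝ≥0∞)⁻¹ * eLpNorm (fun x => (c : ℝ≥0∞) * f x) q μ) := by gcongr
    _ = _ := by rw [← mul_assoc, ENNReal.mul_inv_cancel hc0 ENNReal.coe_ne_top, one_mul]

theorem eLpNorm_ennreal_mono {α : Type*} [MeasurableSpace α] {μ : Measure α}
    {f g : α → ℝ≥0∞} (h : ∀ᵐ x ∂μ, f x ≤ g x) (q : ℝ≥0∞) : eLpNorm f q μ ≤ eLpNorm g q μ :=
  eLpNorm_mono_enorm_ae (by simpa using h)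

theorem ofReal_exp_neg_mul_nat (δ : ℝ) (k : ℕ) :
    ENNReal.ofReal (Real.exp (-(δ * k))) = ENNReal.ofReal (Real.exp (-δ)) ^ k := by
  rw [← ENNReal.ofReal_pow (Real.exp_pos _).le, ← Real.exp_nat_mul]
  congr 2; ring

/-- The sum of a geometric series `∑ e^{-δ k}` is finite. -/
theorem tsum_ofReal_exp_neg_ne_top {δ : ℝ} (hδ : 0 < δ) :
    ∑' k : ℕ, ENNReal.ofReal (Real.exp (-(δ * k))) ≠ ∞ := by
  simp_rw [ofReal_exp_neg_mul_nat, ENNReal.tsum_geometric]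
  refine ENNReal.inv_ne_top.2 (tsub_pos_of_lt ?_).ne'
  rw [ENNReal.ofReal_lt_one, Real.exp_lt_one_iff]
  linarith

/-- A supremum of functions whose `L_q` quasi-norms decay geometrically. -/
theorem exists_eLpNorm_iSup_le {q : ℝ≥0∞} (hq : q ≠ 0) {δ : ℝ} (hδ : 0 < δ) :
    ∃ C : ℝ≥0, ∀ (μ : Measure ℝ) (ψ : ℕ → ℝ → ℝ≥0∞), (∀ k, AEMeasurable (ψ k) μ) →
      ∀ S : ℝ≥0∞, (∀ k : ℕ, eLpNorm (ψ k) q μ ≤ ENNReal.ofReal (Real.exp (-(δ * k))) * S) →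
      eLpNorm (fun x => ⨆ k, ψ k x) q μ ≤ C * S := by
  rcases eq_or_ne q ∞ with rfl | hq'
  · refine ⟨1, fun μ ψ _ S h => ?_⟩
    rw [eLpNorm_exponent_top, ENNReal.coe_one, one_mul]
    refine essSup_le_of_ae_le _ ?_
    have h1 : ∀ k, ∀ᵐ x ∂μ, ψ k x ≤ S := fun k => by
      filter_upwards [enorm_ae_le_eLpNormEssSup (ψ k) μ] with x hx
      refine hx.trans ?_
      rw [← eLpNorm_exponent_top]
      refine (h k).trans ?_
      refine mul_le_of_le_one_left' ?_
      rw [ENNReal.ofReal_le_one, Real.exp_le_one_iff]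
      have : 0 ≤ δ * k := by positivity
      linarith
    filter_upwards [ae_all_iff.2 h1] with x hx
    simpa using hx
  · have hq0 : 0 < q.toReal := ENNReal.toReal_pos hq hq'
    set T : ℝ≥0∞ := ∑' k : ℕ, ENNReal.ofReal (Real.exp (-((δ * q.toReal) * k))) with hT
    have hTt : T ≠ ∞ := tsum_ofReal_exp_neg_ne_top (by positivity)
    have hTt' : T ^ (1 / q.toReal) ≠ ∞ := ENNReal.rpow_ne_top_of_nonneg (by positivity) hTt
    refine ⟨(T ^ (1 / q.toReal)).toNNReal, fun μ ψ hψ S h => ?_⟩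
    rw [ENNReal.coe_toNNReal hTt', eLpNorm_eq_lintegral_rpow_enorm_toReal hq hq']
    simp only [enorm_eq_self]
    have h2 : ∀ k, ∫⁻ x, ψ k x ^ q.toReal ∂μ
        ≤ ENNReal.ofReal (Real.exp (-((δ * q.toReal) * k))) * S ^ q.toReal := fun k => by
      have := ENNReal.rpow_le_rpow (h k) hq0.le
      rw [eLpNorm_eq_lintegral_rpow_enorm_toReal hq hq', ← ENNReal.rpow_mul,
        one_div_mul_cancel hq0.ne', ENNReal.rpow_one, ENNReal.mul_rpow_of_nonneg _ _ hq0.le,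
        ENNReal.ofReal_rpow_of_pos (Real.exp_pos _), ← Real.exp_mul] at this
      simp only [enorm_eq_self] at this
      convert this using 4
      ring
    -- The `q`-th power of a supremum is at most the sum of the `q`-th powers, for every finite `q >
    -- 0`; no triangle inequality enters.
    calc (∫⁻ x, (⨆ k, ψ k x) ^ q.toReal ∂μ) ^ (1 / q.toReal)
        ≤ (∫⁻ x, ∑' k, ψ k x ^ q.toReal ∂μ) ^ (1 / q.toReal) := by
          gcongr with x
          rw [← ENNReal.le_rpow_inv_iff hq0]
          refine iSup_le fun k => ?_
          rw [ENNReal.le_rpow_inv_iff hq0]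
          exact ENNReal.le_tsum k
      _ = (∑' k, ∫⁻ x, ψ k x ^ q.toReal ∂μ) ^ (1 / q.toReal) := by
          rw [lintegral_tsum fun k => (hψ k).pow_const _]
      _ ≤ (T * S ^ q.toReal) ^ (1 / q.toReal) := by
          rw [hT, ← ENNReal.tsum_mul_right]
          gcongr with k
          exact h2 k
      _ = T ^ (1 / q.toReal) * S := by
          rw [ENNReal.mul_rpow_of_nonneg _ _ (by positivity), ← ENNReal.rpow_mul,
            mul_one_div_cancel hq0.ne', ENNReal.rpow_one]

/-! ### Iterated tail norms on the real line -/

/-- The iterated quasi-norm `‖ B(y) ‖ ψ ‖_{q, (y, ∞)} ‖_r` on the real line. -/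
noncomputable def tailNorm (q r : ℝ≥0∞) (B ψ : ℝ → ℝ≥0∞) : ℝ≥0∞ :=
  eLpNorm (fun y => B y * eLpNorm ψ q (volume.restrict (Ioi y))) r volume

theorem antitone_eLpNorm_Ioi (q : ℝ≥0∞) (ψ : ℝ → ℝ≥0∞) :
    Antitone fun y : ℝ => eLpNorm ψ q (volume.restrict (Ioi y)) := fun _ _ h =>
  eLpNorm_mono_measure _ (Measure.restrict_mono (Ioi_subset_Ioi h) le_rfl)

theorem tailNorm_mono {q r : ℝ≥0∞} {B B' ψ ψ' : ℝ → ℝ≥0∞} (hB : ∀ y, B y ≤ B' y)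
    (hψ : ∀ x, ψ x ≤ ψ' x) : tailNorm q r B ψ ≤ tailNorm q r B' ψ' :=
  eLpNorm_ennreal_mono (Filter.Eventually.of_forall fun y =>
    mul_le_mul' (hB y) (eLpNorm_ennreal_mono (Filter.Eventually.of_forall hψ) q)) r

theorem tailNorm_const_mul_left {q r : ℝ≥0∞} {c : ℝ≥0∞} (hc0 : c ≠ 0) (hc : c ≠ ∞)
    (B ψ : ℝ → ℝ≥0∞) : tailNorm q r (fun y => c * B y) ψ = c * tailNorm q r B ψ := by
  simp only [tailNorm, mul_assoc]
  exact eLpNorm_ennreal_const_mul hc0 hc _ _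

theorem tailNorm_const_mul_right {q r : ℝ≥0∞} {c : ℝ≥0∞} (hc0 : c ≠ 0) (hc : c ≠ ∞)
    (B ψ : ℝ → ℝ≥0∞) : tailNorm q r B (fun x => c * ψ x) = c * tailNorm q r B ψ := by
  simp only [tailNorm, eLpNorm_ennreal_const_mul hc0 hc, mul_left_comm _ c]

/-- Change of variables in the iterated quasi-norm. -/
theorem tailNorm_comp {q r : ℝ≥0∞} {e : ℝ → ℝ} (he : MeasurableEmbedding e)
    (hmono : StrictMono e) {c : ℝ≥0∞} (hc0 : c ≠ 0) (hc : c ≠ ∞)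
    (hmap : Measure.map e volume = c • volume) (B ψ : ℝ → ℝ≥0∞) :
    tailNorm q r (fun y => B (e y)) (fun x => ψ (e x)) =
      c ^ (1 / r).toReal * (c ^ (1 / q).toReal * tailNorm q r B ψ) := by
  have hinner : ∀ y, eLpNorm (fun x => ψ (e x)) q (volume.restrict (Ioi y)) =
      c ^ (1 / q).toReal * eLpNorm ψ q (volume.restrict (Ioi (e y))) := fun y => by
    have h1 : Measure.map e (volume.restrict (Ioi y)) = c • volume.restrict (Ioi (e y)) := by
      rw [← Measure.restrict_smul, ← hmap, he.restrict_map]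
      congr 2
      ext x
      simp [hmono.lt_iff_lt]
    rw [← smul_eq_mul, ← eLpNorm_smul_measure_of_ne_zero hc0, ← h1, he.eLpNorm_map_measure]
    rfl
  have hc1 : c ^ (1 / q).toReal ≠ 0 := by
    simp [ENNReal.rpow_eq_zero_iff, hc0, hc]
  have hc2 : c ^ (1 / q).toReal ≠ ∞ := ENNReal.rpow_ne_top_of_nonneg (by positivity) hc
  simp only [tailNorm, hinner, mul_left_comm (B _)]
  rw [eLpNorm_ennreal_const_mul hc1 hc2, mul_left_comm, ← smul_eq_mul (c ^ (1 / r).toReal),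
    ← eLpNorm_smul_measure_of_ne_zero hc0, ← hmap, he.eLpNorm_map_measure]
  rfl

/-- Translating both variables moves the shift from the inner function to the outer weight, because
the half-lines `(y, ∞)` are translated along with `y`. -/
theorem tailNorm_translate (q r : ℝ≥0∞) (h : ℝ) (B ψ : ℝ → ℝ≥0∞) :
    tailNorm q r B (fun x => ψ (x - h)) = tailNorm q r (fun y => B (y + h)) ψ := by
  have := tailNorm_comp (q := q) (r := r) (e := fun x => x - h)
    (MeasurableEquiv.subRight h).measurableEmbedding (fun x y hxy => by simpa using hxy)
    one_ne_zero ENNReal.one_ne_top (by simp [map_sub_right_eq_self]) (fun y => B (y + h)) ψ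
  simpa using this

/-- In logarithmic coordinates this is the passage from `t` to `t ^ κ`. The constant is `κ ^ (-1/q -
1/r)`, independent of the weights and functions. -/
theorem tailNorm_scale (q r : ℝ≥0∞) {κ : ℝ} (hκ : 0 < κ) :
    ∃ c : ℝ≥0∞, c ≠ 0 ∧ c ≠ ∞ ∧ ∀ B ψ : ℝ → ℝ≥0∞,
      tailNorm q r (fun y => B (κ * y)) (fun x => ψ (κ * x)) = c * tailNorm q r B ψ := by
  set c : ℝ≥0∞ := ENNReal.ofReal |κ⁻¹| with hc
  have hc0 : c ≠ 0 := by simp [hc, hκ.ne']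
  have hct : c ≠ ∞ := ENNReal.ofReal_ne_top
  refine ⟨c ^ (1 / r).toReal * c ^ (1 / q).toReal, ?_, ?_, fun B ψ => ?_⟩
  · simp [ENNReal.rpow_eq_zero_iff, hc0, hct]
  · exact ENNReal.mul_ne_top (ENNReal.rpow_ne_top_of_nonneg (by positivity) hct)
      (ENNReal.rpow_ne_top_of_nonneg (by positivity) hct)
  · rw [mul_assoc]
    exact tailNorm_comp (e := fun x => κ * x)
      (Homeomorph.mulLeft₀ κ hκ.ne').measurableEmbedding
      (fun x y hxy => mul_lt_mul_of_pos_left hxy hκ) hc0 hct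
      (Real.map_volume_mul_left hκ.ne') B ψ

/-- A supremum of functions whose iterated quasi-norms decay geometrically. -/
theorem exists_tailNorm_iSup_le {q r : ℝ≥0∞} (hq : q ≠ 0) (hr : r ≠ 0) {δ : ℝ} (hδ : 0 < δ) :
    ∃ C : ℝ≥0, ∀ (B : ℝ → ℝ≥0∞) (ψ : ℕ → ℝ → ℝ≥0∞), AEMeasurable B →
      (∀ k, AEMeasurable (ψ k)) → ∀ S : ℝ≥0∞,
      (∀ k : ℕ, tailNorm q r B (ψ k) ≤ ENNReal.ofReal (Real.exp (-(δ * k))) * S) →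
      tailNorm q r B (fun x => ⨆ k, ψ k x) ≤ C * S := by
  obtain ⟨C₁, h₁⟩ := exists_eLpNorm_iSup_le hq (half_pos hδ)
  obtain ⟨C₂, h₂⟩ := exists_eLpNorm_iSup_le hr (half_pos hδ)
  refine ⟨C₁ * C₂, fun B ψ hB hψ S hS => ?_⟩
  set I : ℕ → ℝ → ℝ≥0∞ := fun k y => eLpNorm (ψ k) q (volume.restrict (Ioi y)) with hI
  -- The decay `e^{-δk}` is split in two: one half pays for the supremum in the inner norm, the
  -- other for the supremum of the weighted inner norms in the outer one.
  set w : ℕ → ℝ≥0∞ := fun k => ENNReal.ofReal (Real.exp (δ / 2 * k)) with hw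
  have hw0 : ∀ k, w k ≠ 0 := fun k => by simp [hw, Real.exp_pos]
  have hwt : ∀ k, w k ≠ ∞ := fun k => ENNReal.ofReal_ne_top
  have hww : ∀ k : ℕ, ENNReal.ofReal (Real.exp (-(δ / 2 * k))) * w k = 1 := fun k => by
    rw [hw, ← ENNReal.ofReal_mul (Real.exp_pos _).le, ← Real.exp_add]
    simp
  have hinner : ∀ y, eLpNorm (fun x => ⨆ k, ψ k x) q (volume.restrict (Ioi y)) ≤
      C₁ * ⨆ k, w k * I k y := fun y => by
    refine h₁ _ ψ (fun k => (hψ k).restrict) _ fun k => ?_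
    calc I k y = ENNReal.ofReal (Real.exp (-(δ / 2 * k))) * (w k * I k y) := by
          rw [← mul_assoc, hww, one_mul]
      _ ≤ _ := by gcongr; exact le_iSup (fun k => w k * I k y) k
  calc tailNorm q r B (fun x => ⨆ k, ψ k x)
      ≤ C₁ * eLpNorm (fun y => ⨆ k, w k * (B y * I k y)) r volume := by
        refine eLpNorm_le_mul_eLpNorm_of_ae_le_mul' (Filter.Eventually.of_forall fun y => ?_) r
        simp only [enorm_eq_self]
        refine (mul_le_mul_right (hinner y) (B y)).trans ?_
        rw [mul_left_comm, ENNReal.mul_iSup]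
        simp only [mul_left_comm (B y)]
        exact le_rfl
    _ ≤ C₁ * (C₂ * S) := by
        gcongr
        refine h₂ _ (fun k y => w k * (B y * I k y)) (fun k => ?_) S fun k => ?_
        · exact (hB.mul (antitone_eLpNorm_Ioi q (ψ k)).measurable.aemeasurable).const_mul _
        · rw [eLpNorm_ennreal_const_mul (hw0 k) (hwt k)]
          refine (mul_le_mul_right (hS k) (w k)).trans ?_
          rw [← mul_assoc, hw, ← ENNReal.ofReal_mul (Real.exp_pos _).le, ← Real.exp_add]
          gcongr
          apply le_of_eq
          ring
    _ = _ := by rw [ENNReal.coe_mul, mul_assoc]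

/-! ### The substitution `u = e ^ x` -/

/-- Under the exponential map Lebesgue measure has the same null sets as Lebesgue measure
on the image. -/
theorem restrict_image_exp_absolutelyContinuous {s : Set ℝ} (hs : MeasurableSet s) :
    Measure.map Real.exp (volume.restrict s) ≪ volume.restrict (Real.exp '' s) ∧
      volume.restrict (Real.exp '' s) ≪ Measure.map Real.exp (volume.restrict s) := by
  have key : ∀ E : Set ℝ, MeasurableSet E →
      (volume.restrict (Real.exp '' s) E = 0 ↔ Measure.map Real.exp (volume.restrict s) E = 0) := by
    intro E hE
    -- The Jacobian `e ^ x` is positive, so the integral vanishes exactly when the indicator does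
    -- almost everywhere.
    rw [← lintegral_indicator_one hE, lintegral_image_eq_lintegral_abs_deriv_mul hs
      (fun x _ => (Real.hasDerivAt_exp x).hasDerivWithinAt) Real.exp_injective.injOn,
      lintegral_eq_zero_iff (by
        refine Measurable.mul (by fun_prop) ?_
        exact (measurable_one.indicator hE).comp Real.measurable_exp),
      Measure.map_apply Real.measurable_exp hE, measure_eq_zero_iff_ae_notMem]
    refine Filter.eventually_congr (Filter.Eventually.of_forall fun x => ?_)
    simp [Real.exp_pos]
  exact ⟨.mk fun E hE => (key E hE).1, .mk fun E hE => (key E hE).2⟩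

/-- The substitution `t = e ^ x` in `L_q` quasi-norms. -/
theorem eLpNorm_image_exp {q : ℝ≥0∞} (hq : q ≠ 0) {s : Set ℝ} (hs : MeasurableSet s)
    (g : ℝ → ℝ≥0∞) :
    eLpNorm (fun t => ENNReal.ofReal (t ^ (-(1 / q).toReal)) * g t) q
      (volume.restrict (Real.exp '' s)) = eLpNorm (fun x => g (Real.exp x)) q
        (volume.restrict s) := by
  have hemb : MeasurableEmbedding Real.exp := Real.isOpenEmbedding_exp.measurableEmbedding
  rcases eq_or_ne q ∞ with rfl | hq'
  -- For `q = ∞` the power weight is trivial and an essential supremum depends only on the null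
  -- sets.
  · have := restrict_image_exp_absolutelyContinuous hs
    simp only [ENNReal.div_top, ENNReal.toReal_zero, neg_zero, Real.rpow_zero, ENNReal.ofReal_one,
      one_mul, eLpNorm_exponent_top, eLpNormEssSup, enorm_eq_self]
    change essSup g _ = essSup (g ∘ Real.exp) _
    rw [← hemb.essSup_map_measure]
    exact le_antisymm (essSup_mono_measure this.2) (essSup_mono_measure this.1)
  · have hq0 : 0 < q.toReal := ENNReal.toReal_pos hq hq'
    rw [eLpNorm_eq_lintegral_rpow_enorm_toReal hq hq', eLpNorm_eq_lintegral_rpow_enorm_toReal hq hq',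
      lintegral_image_eq_lintegral_abs_deriv_mul hs
      (fun x _ => (Real.hasDerivAt_exp x).hasDerivWithinAt) Real.exp_injective.injOn]
    congr 1
    refine lintegral_congr fun x => ?_
    simp only [enorm_eq_self]
    rw [ENNReal.mul_rpow_of_nonneg _ _ hq0.le, ← mul_assoc,
      ENNReal.ofReal_rpow_of_nonneg (by positivity) hq0.le, ← ENNReal.ofReal_mul (by positivity),
      abs_of_pos (Real.exp_pos x), ← Real.exp_mul, ← Real.exp_mul, ← Real.exp_add]
    -- The Jacobian `e ^ x` cancels the `q`-th power of the weight `t ^ (-1/q)`.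
    have : x + x * -(1 / q).toReal * q.toReal = 0 := by
      rw [one_div, ENNReal.toReal_inv]
      field_simp
      ring
    rw [this]
    simp

theorem image_exp_Ioi (y : ℝ) : Real.exp '' Ioi y = Ioi (Real.exp y) := by
  ext t
  simp only [mem_image, mem_Ioi]
  constructor
  · rintro ⟨x, hx, rfl⟩
    exact Real.exp_lt_exp.2 hx
  · intro ht
    have h0 : 0 < t := (Real.exp_pos y).trans ht
    exact ⟨Real.log t, (Real.lt_log_iff_exp_lt h0).2 ht, Real.exp_log h0⟩

theorem weightedNorm_image_exp (σ : ℝ) {q : ℝ≥0∞} (hq : q ≠ 0) (a : ℝ → ℝ) (φ : ℝ → ℝ≥0∞)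
    {s : Set ℝ} (hs : MeasurableSet s) :
    weightedNorm σ q a φ (Real.exp '' s) = eLpNorm (fun x => ENNReal.ofReal
      (Real.exp (σ * x) * a (Real.exp x)) * φ (Real.exp x)) q (volume.restrict s) := by
  have hs' : MeasurableSet (Real.exp '' s) :=
    Real.isOpenEmbedding_exp.measurableEmbedding.measurableSet_image.2 hs
  have h := eLpNorm_image_exp hq hs fun t => ENNReal.ofReal (t ^ σ * a t) * φ t
  simp only [← Real.exp_mul, mul_comm _ σ] at h
  rw [← h]
  refine eLpNorm_congr_ae ?_
  filter_upwards [ae_restrict_mem hs'] with t ht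
  obtain ⟨x, -, rfl⟩ := ht
  rw [← mul_assoc, ← ENNReal.ofReal_mul (by positivity), sub_eq_neg_add,
    Real.rpow_add (Real.exp_pos x), mul_assoc]

/-- The iterated quasi-norm after the substitution `u = e ^ x`. -/
theorem rNorm_eq_tailNorm (σ : ℝ) {r : ℝ≥0∞} (hr : r ≠ 0) (b : ℝ → ℝ) {q : ℝ≥0∞} (hq : q ≠ 0)
    (a : ℝ → ℝ) (φ : ℝ → ℝ≥0∞) :
    rNorm σ r b q a φ = tailNorm q r (fun y => ENNReal.ofReal (b (Real.exp y)))
      (fun x => ENNReal.ofReal (Real.exp (σ * x) * a (Real.exp x)) * φ (Real.exp x)) := by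
  have h0 : Ioi (0 : ℝ) = Real.exp '' univ := by rw [image_univ, Real.range_exp]
  rw [rNorm, h0, weightedNorm_image_exp 0 hr b _ MeasurableSet.univ, tailNorm,
    Measure.restrict_univ]
  simp only [zero_mul, Real.exp_zero, one_mul, ← image_exp_Ioi,
    weightedNorm_image_exp σ hq a φ measurableSet_Ioi]

/-! ### Slowly varying functions in logarithmic coordinates -/

namespace IsSlowlyVarying

variable {b : ℝ → ℝ}

/-- A slowly varying function grows slower than any power. -/
theorem exists_le_exp_mul (hb : IsSlowlyVarying b) {ε : ℝ} (hε : 0 < ε) :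
    ∃ C : ℝ, 0 < C ∧ ∀ x h : ℝ, 0 ≤ h →
      b (Real.exp (x + h)) ≤ C * (Real.exp (ε * h) * b (Real.exp x)) := by
  obtain ⟨g, hg, c, C, hc, hC, H⟩ := hb.equiv_decreasing ε hε
  refine ⟨C / c, by positivity, fun x h hh => ?_⟩
  have h1 := (H _ (Real.exp_pos (x + h))).2
  have h2 := (H _ (Real.exp_pos x)).1
  have h3 : g (Real.exp (x + h)) ≤ g (Real.exp x) :=
    hg (mem_Ioi.2 (Real.exp_pos _)) (mem_Ioi.2 (Real.exp_pos _))
      (Real.exp_le_exp.2 (by linarith))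
  rw [← Real.exp_mul] at h1 h2
  have h4 : Real.exp ((x + h) * -ε) * b (Real.exp (x + h)) ≤
      C * (Real.exp (x * -ε) * b (Real.exp x) / c) := by
    refine h1.trans (mul_le_mul_of_nonneg_left (h3.trans ?_) hC.le)
    rw [le_div_iff₀ hc]
    linarith
  have h5 := mul_le_mul_of_nonneg_left h4 (Real.exp_pos (ε * (x + h))).le
  rw [← mul_assoc, ← Real.exp_add, show ε * (x + h) + (x + h) * -ε = 0 by ring, Real.exp_zero,
    one_mul] at h5
  refine h5.trans (le_of_eq ?_)
  have : Real.exp (ε * h) = Real.exp (ε * (x + h)) * Real.exp (x * -ε) := by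
    rw [← Real.exp_add]; congr 1; ring
  rw [this]
  field_simp

/-- Only almost everywhere measurability is available, so composition needs that `exp` pulls null
sets of the half-line back to null sets. -/
theorem aemeasurable_comp_exp (hb : IsSlowlyVarying b) :
    AEMeasurable fun x : ℝ => b (Real.exp x) := by
  have h := (restrict_image_exp_absolutelyContinuous MeasurableSet.univ).1
  rw [image_univ, Real.range_exp, Measure.restrict_univ] at h
  exact (hb.aemeasurable.mono_ac h).comp_measurable Real.measurable_exp

theorem one : IsSlowlyVarying fun _ => 1 where
  pos _ _ := one_pos
  aemeasurable := aemeasurable_const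
  equiv_increasing ε hε := ⟨fun t => t ^ ε,
    fun _ hx _ _ hxy => Real.rpow_le_rpow (le_of_lt hx) hxy hε.le, 1, 1, one_pos, one_pos,
    fun t _ => by simp⟩
  equiv_decreasing ε hε := ⟨fun t => t ^ (-ε),
    fun _ hx _ _ hxy => Real.rpow_le_rpow_of_nonpos hx hxy (by linarith), 1, 1, one_pos, one_pos,
    fun t _ => by simp⟩

end IsSlowlyVarying

/-! ### Rearrangements and weak-type estimates -/

section Rearrangement

variable {Ω : Type*} [MeasurableSpace Ω] {μ : Measure Ω} {𝕜 : Type*} [RCLike 𝕜]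

theorem antitone_rearrangement (f : Ω →ₘ[μ] 𝕜) : Antitone (rearrangement f) := fun _ _ h =>
  sInf_le_sInf fun _ hs => le_trans hs (ENNReal.ofReal_le_ofReal h)

/-- The infimum in the definition of the rearrangement is attained. -/
theorem measure_rearrangement_lt_le (f : Ω →ₘ[μ] 𝕜) (t : ℝ) :
    μ {x | rearrangement f t < ‖f x‖ₑ} ≤ ENNReal.ofReal t := by
  set S : Set ℝ≥0∞ := {s | μ {x | s < ‖f x‖ₑ} ≤ ENNReal.ofReal t} with hS
  have hne : S.Nonempty := ⟨∞, by simp [hS]⟩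
  obtain ⟨u, hu, hlim, hmem⟩ := exists_seq_tendsto_sInf hne (OrderBot.bddBelow S)
  have hunion : {x | rearrangement f t < ‖f x‖ₑ} = ⋃ n, {x | u n < ‖f x‖ₑ} := by
    ext x
    simp only [mem_ofPred_eq, mem_iUnion]
    constructor
    · intro hx
      exact (hlim.eventually (gt_mem_nhds hx)).exists
    · rintro ⟨n, hn⟩
      exact (sInf_le (hmem n)).trans_lt hn
  have hmono : Monotone fun n => {x | u n < ‖f x‖ₑ} := fun m n hmn x hx =>
    (hu hmn).trans_lt hx
  rw [hunion, hmono.measure_iUnion]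
  exact iSup_le hmem

/-- Where `|f| ≤ f^*(t)`, almost everywhere `|f + g| ≤ f^*(t) + ‖g‖_∞`; the exceptional set has
measure at most `t` because the infimum defining `f^*(t)` is attained. -/
theorem rearrangement_add_le (f g : Ω →ₘ[μ] 𝕜) (t : ℝ) :
    rearrangement (f + g) t ≤ rearrangement f t + eLpNorm g ∞ μ := by
  refine sInf_le ?_
  refine le_trans (measure_mono_ae ?_) (measure_rearrangement_lt_le f t)
  filter_upwards [AEEqFun.coeFn_add f g, enorm_ae_le_eLpNormEssSup g μ] with x hx hg hlt
  have hlt' : rearrangement f t + eLpNorm g ∞ μ < ‖(f + g : Ω →ₘ[μ] 𝕜) x‖ₑ := hlt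
  rw [hx, Pi.add_apply] at hlt'
  change rearrangement f t < ‖f x‖ₑ
  by_contra hcon
  rw [not_lt] at hcon
  exact absurd (hlt'.trans_le ((enorm_add_le _ _).trans
    (add_le_add hcon (by rw [eLpNorm_exponent_top]; exact hg)))) (lt_irrefl _)

/-- The weak-type estimate for `L_κ`. -/
theorem ofReal_rpow_mul_rearrangement_le {κ : ℝ} (hκ : 0 < κ) (f : Ω →ₘ[μ] 𝕜) {t : ℝ}
    (ht : 0 < t) :
    ENNReal.ofReal (t ^ (1 / κ)) * rearrangement f t ≤ eLpNorm f (ENNReal.ofReal κ) μ := by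
  set N := eLpNorm f (ENNReal.ofReal κ) μ with hN
  have hκ0 : ENNReal.ofReal κ ≠ 0 := by simpa using hκ
  have hT0 : ENNReal.ofReal (t ^ (1 / κ)) ≠ 0 := by simpa using Real.rpow_pos_of_pos ht _
  rw [mul_comm, ← ENNReal.le_div_iff_mul_le (.inl hT0) (.inl ENNReal.ofReal_ne_top)]
  refine sInf_le ?_
  set s := N / ENNReal.ofReal (t ^ (1 / κ)) with hs
  change μ {x | s < ‖f x‖ₑ} ≤ ENNReal.ofReal t
  rcases eq_or_ne N ∞ with hN' | hN'
  · have : s = ∞ := by rw [hs, hN', ENNReal.top_div_of_ne_top ENNReal.ofReal_ne_top]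
    simp [this]
  rcases eq_or_ne N 0 with h0 | h0
  · have hf := (eLpNorm_eq_zero_iff f.aestronglyMeasurable hκ0).1 (hN ▸ h0)
    have hs0 : s = 0 := by rw [hs, h0, ENNReal.zero_div]
    have : μ {x | s < ‖f x‖ₑ} = 0 := by
      rw [measure_eq_zero_iff_ae_notMem]
      filter_upwards [hf] with x hx
      simp [hx]
    simp [this]
  have hs0 : s ≠ 0 := by simp [hs, h0]
  have hst : s ≠ ∞ := ENNReal.div_ne_top hN' hT0
  have h := mul_meas_ge_le_pow_eLpNorm' (p := ENNReal.ofReal κ) μ hκ0 ENNReal.ofReal_ne_top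
    f.aestronglyMeasurable s
  rw [ENNReal.toReal_ofReal hκ.le, ← hN] at h
  have hN2 : N ^ κ = s ^ κ * ENNReal.ofReal t := by
    have : N = s * ENNReal.ofReal (t ^ (1 / κ)) := by
      rw [hs, ENNReal.div_mul_cancel hT0 ENNReal.ofReal_ne_top]
    rw [this, ENNReal.mul_rpow_of_nonneg _ _ hκ.le,
      ENNReal.ofReal_rpow_of_nonneg (by positivity) hκ.le, ← Real.rpow_mul ht.le,
      one_div_mul_cancel hκ.ne', Real.rpow_one]
  rw [hN2] at h
  have hsk0 : s ^ κ ≠ 0 := by simp [ENNReal.rpow_eq_zero_iff, hs0, hst]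
  have hskt : s ^ κ ≠ ∞ := ENNReal.rpow_ne_top_of_nonneg hκ.le hst
  exact (measure_mono fun x (hx : s < _) => hx.le).trans
    ((ENNReal.mul_le_mul_iff_right hsk0 hskt).1 h)

theorem lorentzSpace_top_qnorm {κ : ℝ} (hκ : 0 < κ) (f : Ω →ₘ[μ] 𝕜) :
    (lorentzSpace μ 𝕜 (ENNReal.ofReal κ) ∞).qnorm f = eLpNorm (fun x : ℝ =>
      ENNReal.ofReal (Real.exp (x / κ)) * rearrangement f (Real.exp x)) ∞ volume := by
  have h0 : Ioi (0 : ℝ) = Real.exp '' univ := by rw [image_univ, Real.range_exp]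
  have hσ : (1 / ENNReal.ofReal κ).toReal = 1 / κ := by
    rw [ENNReal.toReal_div, ENNReal.toReal_ofReal hκ.le, ENNReal.toReal_one]
  change weightedNorm (1 / ENNReal.ofReal κ).toReal ∞ (fun _ => 1) (rearrangement f) (Ioi 0) = _
  rw [h0, weightedNorm_image_exp _ ENNReal.top_ne_zero _ _ MeasurableSet.univ,
    Measure.restrict_univ, hσ]
  simp only [mul_one, one_div_mul_eq_div]

theorem lorentzSpace_top_qnorm_le {κ : ℝ} (hκ : 0 < κ) (f : Ω →ₘ[μ] 𝕜) :
    (lorentzSpace μ 𝕜 (ENNReal.ofReal κ) ∞).qnorm f ≤ eLpNorm f (ENNReal.ofReal κ) μ := by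
  rw [lorentzSpace_top_qnorm hκ, eLpNorm_exponent_top]
  refine essSup_le_of_ae_le _ (Filter.Eventually.of_forall fun x => ?_)
  have := ofReal_rpow_mul_rearrangement_le hκ f (Real.exp_pos x)
  rw [← Real.exp_mul, mul_one_div] at this
  simpa using this

/-- The quasi-norm is an essential supremum, but a bound at every point is needed. A good point
exists just to the left of `κ * x`, and monotonicity of `f^*` carries its bound over; the factor
`e⁻¹` pays for the gap. -/
theorem mul_rearrangement_le_lorentzSpace_top_qnorm {κ : ℝ} (hκ : 0 < κ) (f : Ω →ₘ[μ] 𝕜)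
    (x : ℝ) : ENNReal.ofReal (Real.exp (x - 1)) * rearrangement f (Real.exp (κ * x)) ≤
      (lorentzSpace μ 𝕜 (ENNReal.ofReal κ) ∞).qnorm f := by
  rw [lorentzSpace_top_qnorm hκ, eLpNorm_exponent_top]
  have hae := enorm_ae_le_eLpNormEssSup (fun x : ℝ =>
      ENNReal.ofReal (Real.exp (x / κ)) * rearrangement f (Real.exp x)) volume
  have hpos : volume (Ioo (κ * (x - 1)) (κ * x)) ≠ 0 := by
    rw [Real.volume_Ioo]
    simpa [mul_sub] using hκ
  obtain ⟨y, hy, hle⟩ : ∃ y ∈ Ioo (κ * (x - 1)) (κ * x),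
      ‖ENNReal.ofReal (Real.exp (y / κ)) * rearrangement f (Real.exp y)‖ₑ ≤ _ := by
    by_contra hcon
    push Not at hcon
    refine hpos (measure_mono_null (fun y hy => ?_) hae)
    exact not_le.2 (hcon y hy)
  refine le_trans ?_ hle
  rw [enorm_eq_self]
  refine mul_le_mul' (ENNReal.ofReal_le_ofReal (Real.exp_le_exp.2 ?_))
    (antitone_rearrangement f (Real.exp_le_exp.2 hy.2.le))
  rw [le_div_iff₀ hκ]
  linarith [hy.1]

end Rearrangement

/-! ### Two-sided estimates of the `K`-functional -/

section Peetre

variable {Ω : Type*} [MeasurableSpace Ω] {μ : Measure Ω} {𝕜 : Type*} [RCLike 𝕜]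

theorem peetreK_mono {A₀ A₀' A₁ : FunctionSpace μ 𝕜} (hc : A₀'.carrier ⊆ A₀.carrier)
    (hN : ∀ f ∈ A₀'.carrier, A₀.qnorm f ≤ A₀'.qnorm f) (f : Ω →ₘ[μ] 𝕜) (t : ℝ) :
    peetreK A₀ A₁ f t ≤ peetreK A₀' A₁ f t := by
  refine le_sInf ?_
  rintro _ ⟨f₀, h₀, f₁, h₁, hf, rfl⟩
  refine le_trans (b := A₀.qnorm f₀ + ENNReal.ofReal t * A₁.qnorm f₁) (sInf_le ?_) ?_
  · exact ⟨f₀, hc h₀, f₁, h₁, hf, rfl⟩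
  · exact add_le_add_left (hN f₀ h₀) _

theorem peetreK_eq_top {A₀ A₁ : FunctionSpace μ 𝕜} {f : Ω →ₘ[μ] 𝕜} (hf : f ∉ sumCarrier A₀ A₁)
    (t : ℝ) : peetreK A₀ A₁ f t = ∞ := by
  rw [peetreK, sInf_eq_top]
  rintro _ ⟨f₀, h₀, f₁, h₁, h, -⟩
  exact absurd ⟨f₀, h₀, f₁, h₁, h⟩ hf

/-- Lower estimate of the `K`-functional of `(L_{κ,∞}, L_∞)`. -/
theorem mul_rearrangement_le_peetreK {κ : ℝ} (hκ : 0 < κ) (f : Ω →ₘ[μ] 𝕜) (x : ℝ) :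
    ENNReal.ofReal (Real.exp (x - 1)) * rearrangement f (Real.exp (κ * x)) ≤
      peetreK (lorentzSpace μ 𝕜 (ENNReal.ofReal κ) ∞) (lebesgueSpace μ 𝕜 ∞) f (Real.exp x) := by
  refine le_sInf ?_
  rintro _ ⟨f₀, -, f₁, -, rfl, rfl⟩
  refine (mul_le_mul_right (rearrangement_add_le f₀ f₁ _) _).trans ?_
  rw [mul_add]
  refine add_le_add (mul_rearrangement_le_lorentzSpace_top_qnorm hκ f₀ x) ?_
  exact mul_le_mul_left (ENNReal.ofReal_le_ofReal (Real.exp_le_exp.2 (by linarith))) _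

/-- Summation over the level sets of `|f|` between the values of `f^*` along a sequence. -/
theorem lintegral_indicator_rearrangement_le {κ : ℝ} (hκ : 0 < κ) (f : Ω →ₘ[μ] 𝕜) {t : ℕ → ℝ}
    (ht : Filter.Tendsto t Filter.atTop (nhds 0)) :
    ∫⁻ ω in {ω | rearrangement f (t 0) < ‖f ω‖ₑ}, ‖f ω‖ₑ ^ κ ∂μ ≤
      ∑' k, rearrangement f (t (k + 1)) ^ κ * ENNReal.ofReal (t k) := by
  set E : ℕ → Set Ω := fun k => {ω | rearrangement f (t k) < ‖f ω‖ₑ} with hE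
  have hmeas : ∀ k, MeasurableSet (E k) := fun k =>
    measurableSet_lt measurable_const f.stronglyMeasurable.measurable.enorm
  -- The intersection lies in every `E k`, whose measure is at most `t k → 0`. Hence almost every
  -- point of `E 0` leaves the sets at some index.
  have hnull : μ (⋂ k, E k) = 0 := by
    refine le_antisymm (ge_of_tendsto' (x := Filter.atTop)
      (f := fun k => ENNReal.ofReal (t k)) ?_ fun k => ?_) zero_le
    · simpa using ENNReal.tendsto_ofReal ht
    · exact (measure_mono (iInter_subset _ k)).trans (measure_rearrangement_lt_le f (t k))
  rw [← lintegral_indicator (hmeas 0)]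
  calc ∫⁻ ω, (E 0).indicator (fun ω => ‖f ω‖ₑ ^ κ) ω ∂μ
      ≤ ∫⁻ ω, ∑' k, (E k).indicator (fun _ => rearrangement f (t (k + 1)) ^ κ) ω ∂μ := by
        refine lintegral_mono_ae ?_
        filter_upwards [measure_eq_zero_iff_ae_notMem.1 hnull] with ω hω
        by_cases h0 : ω ∈ E 0
        · have hex : ∃ k, ω ∉ E k := by simpa using hω
          classical
          -- At an exit index `k`, `|f ω| ≤ f^*(t (k + 1))` while `ω ∈ E k`: hence the shifted index
          -- in the sum.
          obtain ⟨k, hk, hk'⟩ : ∃ k, ω ∈ E k ∧ ω ∉ E (k + 1) := by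
            by_contra hcon
            push Not at hcon
            obtain ⟨k, hk⟩ := hex
            exact hk (Nat.rec h0 (fun n hn => hcon n hn) k)
          refine le_trans ?_ (ENNReal.le_tsum k)
          rw [indicator_of_mem h0, indicator_of_mem hk]
          exact ENNReal.rpow_le_rpow (not_lt.1 hk') hκ.le
        · rw [indicator_of_notMem h0]
          exact zero_le
    _ = ∑' k, rearrangement f (t (k + 1)) ^ κ * μ (E k) := by
        rw [lintegral_tsum fun k => (measurable_const.indicator (hmeas k)).aemeasurable]
        simp only [lintegral_indicator_const (hmeas _)]
    _ ≤ _ := by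
        gcongr with k
        exact measure_rearrangement_lt_le f (t k)

/-- Upper estimate of the `K`-functional of `(L_κ, L_∞)`. -/
theorem exists_peetreK_lebesgueSpace_le {κ η : ℝ} (hκ : 0 < κ) (hη : κ * η < 1) :
    ∃ C : ℝ≥0, ∀ (f : Ω →ₘ[μ] 𝕜) (x : ℝ),
      peetreK (lebesgueSpace μ 𝕜 (ENNReal.ofReal κ)) (lebesgueSpace μ 𝕜 ∞) f (Real.exp x) ≤
        C * ⨆ k : ℕ, ENNReal.ofReal (Real.exp (x - η * k)) *
          rearrangement f (Real.exp (κ * x - k)) := by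
  set D : ℝ≥0∞ := ∑' k : ℕ, ENNReal.ofReal (Real.exp (-((1 - κ * η) * k))) with hD
  have hDt : D ≠ ∞ := tsum_ofReal_exp_neg_ne_top (by linarith)
  set C₀ : ℝ≥0∞ := (ENNReal.ofReal (Real.exp (κ * η)) * D) ^ (1 / κ) with hC₀
  have hC₀t : C₀ ≠ ∞ := ENNReal.rpow_ne_top_of_nonneg (by positivity)
    (ENNReal.mul_ne_top ENNReal.ofReal_ne_top hDt)
  -- `C₀` comes from the part of `f` above the cut, and `1` from the bounded part.
  refine ⟨C₀.toNNReal + 1, fun f x => ?_⟩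
  rw [ENNReal.coe_add, ENNReal.coe_toNNReal hC₀t, ENNReal.coe_one]
  set M := ⨆ k : ℕ, ENNReal.ofReal (Real.exp (x - η * k)) *
          rearrangement f (Real.exp (κ * x - k)) with hM
  rcases eq_or_ne M ∞ with hMt | hMt
  · rw [hMt, ENNReal.mul_top (by simp)]
    exact le_top
  set t : ℕ → ℝ := fun k => Real.exp (κ * x - k) with ht
  have hlim : Filter.Tendsto t Filter.atTop (nhds 0) := by
    refine Real.tendsto_exp_atBot.comp ?_
    simpa [sub_eq_add_neg] using Filter.tendsto_atBot_add_const_left _ (κ * x)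
      (Filter.tendsto_neg_atTop_atBot.comp tendsto_natCast_atTop_atTop)
  have hle : ∀ k : ℕ, rearrangement f (t k) ≤ ENNReal.ofReal (Real.exp (η * k - x)) * M := by
    intro k
    have h := le_iSup (fun k : ℕ => ENNReal.ofReal (Real.exp (x - η * k)) *
          rearrangement f (Real.exp (κ * x - k))) k
    calc rearrangement f (t k) = ENNReal.ofReal (Real.exp (η * k - x)) *
          (ENNReal.ofReal (Real.exp (x - η * k)) * rearrangement f (t k)) := by
          rw [← mul_assoc, ← ENNReal.ofReal_mul (Real.exp_pos _).le, ← Real.exp_add]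
          simp
      _ ≤ _ := by gcongr
  set E : Set Ω := {ω | rearrangement f (t 0) < ‖f ω‖ₑ} with hE
  have hEm : MeasurableSet E :=
    measurableSet_lt measurable_const f.stronglyMeasurable.measurable.enorm
  -- Cut at height `f^*(e^{κx})`: `f₀` is `f` on the set above this height, `f₁` is `f` elsewhere.
  set f₀ : Ω →ₘ[μ] 𝕜 := AEEqFun.mk (E.indicator f)
    (f.stronglyMeasurable.indicator hEm).aestronglyMeasurable with hf₀
  set f₁ : Ω →ₘ[μ] 𝕜 := AEEqFun.mk (Eᶜ.indicator f)
    (f.stronglyMeasurable.indicator hEm.compl).aestronglyMeasurable with hf₁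
  have hf : f = f₀ + f₁ := by
    refine AEEqFun.ext ?_
    filter_upwards [AEEqFun.coeFn_add f₀ f₁, AEEqFun.coeFn_mk (E.indicator f)
      (f.stronglyMeasurable.indicator hEm).aestronglyMeasurable (μ := μ),
      AEEqFun.coeFn_mk (Eᶜ.indicator f)
      (f.stronglyMeasurable.indicator hEm.compl).aestronglyMeasurable (μ := μ)] with ω h h0 h1
    rw [h, Pi.add_apply, hf₀, hf₁, h0, h1, ← Pi.add_apply, indicator_self_add_compl]
  have hκ0 : ENNReal.ofReal κ ≠ 0 := by simpa using hκ
  have hN₀ : eLpNorm f₀ (ENNReal.ofReal κ) μ ≤ C₀ * M := by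
    rw [eLpNorm_congr_ae (AEEqFun.coeFn_mk _ _), eLpNorm_indicator_eq_eLpNorm_restrict hEm,
      eLpNorm_eq_lintegral_rpow_enorm_toReal hκ0 ENNReal.ofReal_ne_top,
      ENNReal.toReal_ofReal hκ.le]
    -- By `hle`, the `k`-th term is at most `e^{κη(k+1) - κx} M^κ e^{κx - k}`. The `x`-dependence
    -- cancels, leaving a geometric series of ratio `e^{-(1-κη)} < 1`.
    have hsum : ∫⁻ ω in E, ‖f ω‖ₑ ^ κ ∂μ ≤ ENNReal.ofReal (Real.exp (κ * η)) * D * M ^ κ := by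
      refine (lintegral_indicator_rearrangement_le hκ f hlim).trans ?_
      rw [hD, ← ENNReal.tsum_mul_left, ← ENNReal.tsum_mul_right]
      refine ENNReal.tsum_le_tsum fun k => ?_
      calc rearrangement f (t (k + 1)) ^ κ * ENNReal.ofReal (t k)
          ≤ (ENNReal.ofReal (Real.exp (η * (k + 1 : ℕ) - x)) * M) ^ κ * ENNReal.ofReal (t k) := by
            gcongr
            exact hle (k + 1)
        _ = _ := by
            rw [ENNReal.mul_rpow_of_nonneg _ _ hκ.le, mul_right_comm,
              ENNReal.ofReal_rpow_of_pos (Real.exp_pos _), ← Real.exp_mul,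
              ← ENNReal.ofReal_mul (Real.exp_pos _).le, ← ENNReal.ofReal_mul (Real.exp_pos _).le,
              ← Real.exp_add, ← Real.exp_add]
            congr 3
            push_cast
            ring
    calc (∫⁻ ω in E, ‖f ω‖ₑ ^ κ ∂μ) ^ (1 / κ)
        ≤ (ENNReal.ofReal (Real.exp (κ * η)) * D * M ^ κ) ^ (1 / κ) := by gcongr
      _ = C₀ * M := by
          rw [ENNReal.mul_rpow_of_nonneg _ _ (by positivity : (0 : ℝ) ≤ 1 / κ), ← ENNReal.rpow_mul,
            mul_one_div_cancel hκ.ne', ENNReal.rpow_one]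
  have hN₁ : eLpNorm f₁ ∞ μ ≤ ENNReal.ofReal (Real.exp (-x)) * M := by
    rw [eLpNorm_congr_ae (AEEqFun.coeFn_mk _ _), eLpNorm_exponent_top]
    refine essSup_le_of_ae_le _ (Filter.Eventually.of_forall fun ω => ?_)
    have h0 := hle 0
    rw [Nat.cast_zero, mul_zero, zero_sub] at h0
    refine le_trans ?_ h0
    by_cases hω : ω ∈ E
    · simp [hω]
    · change ‖Eᶜ.indicator f ω‖ₑ ≤ _
      rw [indicator_of_mem (mem_compl hω)]
      exact not_lt.1 hω
  refine le_trans (b := eLpNorm f₀ (ENNReal.ofReal κ) μ + ENNReal.ofReal (Real.exp x) *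
    eLpNorm f₁ ∞ μ) (sInf_le ⟨f₀, ?_, f₁, ?_, hf, rfl⟩) ?_
  · exact hN₀.trans_lt (ENNReal.mul_lt_top hC₀t.lt_top hMt.lt_top)
  · exact hN₁.trans_lt (ENNReal.mul_lt_top ENNReal.ofReal_lt_top hMt.lt_top)
  · rw [add_mul, one_mul]
    refine add_le_add hN₀ ?_
    calc ENNReal.ofReal (Real.exp x) * eLpNorm f₁ ∞ μ
        ≤ ENNReal.ofReal (Real.exp x) * (ENNReal.ofReal (Real.exp (-x)) * M) := by gcongr
      _ = M := by
        rw [← mul_assoc, ← ENNReal.ofReal_mul (Real.exp_pos _).le, ← Real.exp_add]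
        simp

end Peetre

/-! ### Dilations and power substitutions in the iterated norms -/

section Dilation

variable {a b : ℝ → ℝ} {q r : ℝ≥0∞}

/-- The dilation `f^*(t) ↦ f^*(e^{-h} t)` in the iterated quasi-norm. -/
theorem exists_tailNorm_dilation_le (ha : IsSlowlyVarying a) (hb : IsSlowlyVarying b) (q r : ℝ≥0∞)
    (σ : ℝ) {ε : ℝ} (hε : 0 < ε) :
    ∃ C : ℝ≥0, ∀ (F : ℝ → ℝ≥0∞) (h : ℝ), 0 ≤ h →
      tailNorm q r (fun y => ENNReal.ofReal (b (Real.exp y)))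
          (fun x => ENNReal.ofReal (Real.exp (σ * x) * a (Real.exp x)) * F (x - h)) ≤
        C * (ENNReal.ofReal (Real.exp ((σ + 2 * ε) * h)) *
          tailNorm q r (fun y => ENNReal.ofReal (b (Real.exp y)))
            (fun x => ENNReal.ofReal (Real.exp (σ * x) * a (Real.exp x)) * F x)) := by
  obtain ⟨Ca, hCa, hA⟩ := ha.exists_le_exp_mul hε
  obtain ⟨Cb, hCb, hB⟩ := hb.exists_le_exp_mul hε
  refine ⟨(Ca * Cb).toNNReal, fun F h hh => ?_⟩
  set ψ : ℝ → ℝ≥0∞ := fun x => ENNReal.ofReal (Real.exp (σ * x) * a (Real.exp x)) * F x with hψ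
  -- Shifting back by `h` costs `e^{σh}` from the power, `e^{εh}` from `a` and `e^{εh}` from `b`,
  -- whence the exponent `σ + 2ε`.
  set c₁ : ℝ := Ca * Real.exp ((σ + ε) * h) with hc₁
  set c₂ : ℝ := Cb * Real.exp (ε * h) with hc₂
  have h₁ : 0 < c₁ := by positivity
  have h₂ : 0 < c₂ := by positivity
  have hpt : ∀ x, ENNReal.ofReal (Real.exp (σ * x) * a (Real.exp x)) * F (x - h) ≤
      ENNReal.ofReal c₁ * ψ (x - h) := fun x => by
    rw [hψ, ← mul_assoc, ← ENNReal.ofReal_mul h₁.le]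
    refine mul_le_mul_left (ENNReal.ofReal_le_ofReal ?_) _
    have := hA (x - h) h hh
    rw [sub_add_cancel] at this
    refine (mul_le_mul_of_nonneg_left this (Real.exp_pos _).le).trans (le_of_eq ?_)
    have he : Real.exp (σ * x) * Real.exp (ε * h) =
        Real.exp ((σ + ε) * h) * Real.exp (σ * (x - h)) := by
      rw [← Real.exp_add, ← Real.exp_add]
      congr 1
      ring
    linear_combination Ca * a (Real.exp (x - h)) * he
  have hpb : ∀ y, ENNReal.ofReal (b (Real.exp (y + h))) ≤
      ENNReal.ofReal c₂ * ENNReal.ofReal (b (Real.exp y)) := fun y => by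
    rw [← ENNReal.ofReal_mul h₂.le]
    gcongr
    rw [hc₂, mul_assoc]
    exact hB y h hh
  calc _ ≤ tailNorm q r (fun y => ENNReal.ofReal (b (Real.exp y)))
          (fun x => ENNReal.ofReal c₁ * ψ (x - h)) := tailNorm_mono (fun _ => le_rfl) hpt
    _ = ENNReal.ofReal c₁ * tailNorm q r (fun y => ENNReal.ofReal (b (Real.exp (y + h)))) ψ := by
      rw [tailNorm_const_mul_right (by simpa using h₁) ENNReal.ofReal_ne_top, tailNorm_translate]
    _ ≤ ENNReal.ofReal c₁ * (ENNReal.ofReal c₂ *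
          tailNorm q r (fun y => ENNReal.ofReal (b (Real.exp y))) ψ) := by
      rw [← tailNorm_const_mul_left (c := ENNReal.ofReal c₂) (by simpa using h₂)
        ENNReal.ofReal_ne_top]
      refine mul_le_mul_right ?_ _
      exact tailNorm_mono hpb fun _ => le_rfl
    _ = _ := by
      rw [← mul_assoc, ← mul_assoc, ← ENNReal.ofReal_mul h₁.le]
      congr 1
      change _ = ENNReal.ofReal (Ca * Cb) * _
      rw [← ENNReal.ofReal_mul (by positivity), hc₁, hc₂]
      congr 1
      rw [show (σ + 2 * ε) * h = (σ + ε) * h + ε * h by ring, Real.exp_add]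
      ring

theorem aemeasurable_exp_mul_slowlyVarying (ha : IsSlowlyVarying a) (σ : ℝ) :
    AEMeasurable fun x : ℝ => ENNReal.ofReal (Real.exp (σ * x) * a (Real.exp x)) :=
  ((Measurable.aemeasurable (by fun_prop)).mul ha.aemeasurable_comp_exp).ennreal_ofReal

/-- This produces the weights `a(t^{1/κ})` and `b(t^{1/κ})`; with `σ = 1 - θ` the new exponent `σ /
κ` is `1/p`. -/
theorem exists_rNorm_rpow_eq (q r : ℝ≥0∞) (hq : q ≠ 0) (hr : r ≠ 0) (a b : ℝ → ℝ) (σ : ℝ) {κ : ℝ}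
    (hκ : 0 < κ) :
    ∃ c : ℝ≥0∞, c ≠ 0 ∧ c ≠ ∞ ∧ ∀ φ : ℝ → ℝ≥0∞,
      tailNorm q r (fun y => ENNReal.ofReal (b (Real.exp y)))
          (fun x => ENNReal.ofReal (Real.exp (σ * x) * a (Real.exp x)) * φ (Real.exp (κ * x))) =
        c * rNorm (σ / κ) r (fun t => b (t ^ (1 / κ))) q (fun t => a (t ^ (1 / κ))) φ := by
  obtain ⟨c, hc0, hct, hc⟩ := tailNorm_scale q r hκ
  refine ⟨c, hc0, hct, fun φ => ?_⟩
  rw [rNorm_eq_tailNorm _ hr _ hq, ← hc]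
  have h1 : ∀ x, Real.exp (κ * x) ^ (1 / κ) = Real.exp x := fun x => by
    rw [← Real.exp_mul]
    congr 1
    field_simp
  have h2 : ∀ x, σ / κ * (κ * x) = σ * x := fun x => by field_simp
  simp only [h1, h2]

theorem rNorm_top (hq : q ≠ 0) (hr : r ≠ 0) (σ : ℝ) (ha : IsSlowlyVarying a)
    (hb : IsSlowlyVarying b) : rNorm σ r b q a (fun _ => ∞) = ∞ := by
  have hconst : ∀ {p : ℝ≥0∞} {s : Set ℝ}, p ≠ 0 → volume s = ∞ →
      eLpNorm (fun _ : ℝ => (∞ : ℝ≥0∞)) p (volume.restrict s) = ∞ := by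
    intro p s hp hs
    have hne : volume.restrict s ≠ 0 := by
      rw [Ne, Measure.restrict_eq_zero, hs]
      exact ENNReal.top_ne_zero
    rw [eLpNorm_const _ hp hne, enorm_eq_self, Measure.restrict_apply_univ, hs,
      ENNReal.top_mul]
    simp [ENNReal.rpow_eq_zero_iff]
  have h1 : ∀ x, ENNReal.ofReal (Real.exp (σ * x) * a (Real.exp x)) * ∞ = ∞ := fun x =>
    ENNReal.mul_top (by simpa using mul_pos (Real.exp_pos _) (ha.pos _ (Real.exp_pos x)))
  have h2 : ∀ x, ENNReal.ofReal (b (Real.exp x)) * ∞ = ∞ := fun x =>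
    ENNReal.mul_top (by simpa using hb.pos _ (Real.exp_pos x))
  rw [rNorm_eq_tailNorm σ hr b hq, tailNorm]
  simp only [h1, hconst hq Real.volume_Ioi, h2]
  simpa using hconst hr Real.volume_univ

end Dilation

/-! ### Comparison of the three spaces -/

section Spaces

variable {Ω : Type*} [MeasurableSpace Ω] {μ : Measure Ω} {𝕜 : Type*} [RCLike 𝕜]
  {a b : ℝ → ℝ} {q r : ℝ≥0∞} {θ κ : ℝ}

/-- Outside `A₀ + A₁` the `K`-functional is an infimum over the empty set, hence `∞`, and the
positive weights make the quasi-norm infinite. So the condition `f ∈ A₀ + A₁` is automatic. -/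
theorem mem_rInterpolationSpace_iff (A₀ A₁ : FunctionSpace μ 𝕜) (hq : q ≠ 0) (hr : r ≠ 0)
    (ha : IsSlowlyVarying a) (hb : IsSlowlyVarying b) (f : Ω →ₘ[μ] 𝕜) :
    f ∈ (rInterpolationSpace A₀ A₁ θ r b q a).carrier ↔
      (rInterpolationSpace A₀ A₁ θ r b q a).qnorm f < ∞ := by
  refine ⟨fun h => h.2, fun h => ⟨?_, h⟩⟩
  by_contra hf
  have hK : peetreK A₀ A₁ f = fun _ => ∞ := funext (peetreK_eq_top hf)
  change rNorm (-θ) r b q a (peetreK A₀ A₁ f) < ∞ at h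
  rw [hK, rNorm_top hq hr _ ha hb] at h
  exact lt_irrefl _ h

theorem FunctionSpace.embeds_of_qnorm_le {X Y : FunctionSpace μ 𝕜}
    (hX : ∀ f, f ∈ X.carrier → X.qnorm f < ∞) (hY : ∀ f, Y.qnorm f < ∞ → f ∈ Y.carrier)
    {C : ℝ≥0} (h : ∀ f, Y.qnorm f ≤ C * X.qnorm f) : X.Embeds Y :=
  ⟨fun f hf => hY f ((h f).trans_lt (ENNReal.mul_lt_top ENNReal.coe_lt_top (hX f hf))),
    C, fun f _ => h f⟩

theorem peetreK_lorentzSpace_le (hκ : 0 < κ) (f : Ω →ₘ[μ] 𝕜) (t : ℝ) :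
    peetreK (lorentzSpace μ 𝕜 (ENNReal.ofReal κ) ∞) (lebesgueSpace μ 𝕜 ∞) f t ≤
      peetreK (lebesgueSpace μ 𝕜 (ENNReal.ofReal κ)) (lebesgueSpace μ 𝕜 ∞) f t :=
  peetreK_mono (fun f hf => (lorentzSpace_top_qnorm_le hκ f).trans_lt hf)
    (fun f _ => lorentzSpace_top_qnorm_le hκ f) f t

theorem rInterpolationSpace_lorentzSpace_qnorm_le (hq : q ≠ 0) (hr : r ≠ 0) (hκ : 0 < κ)
    (f : Ω →ₘ[μ] 𝕜) :
    (rInterpolationSpace (lorentzSpace μ 𝕜 (ENNReal.ofReal κ) ∞) (lebesgueSpace μ 𝕜 ∞)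
        θ r b q a).qnorm f ≤
      (rInterpolationSpace (lebesgueSpace μ 𝕜 (ENNReal.ofReal κ)) (lebesgueSpace μ 𝕜 ∞)
        θ r b q a).qnorm f := by
  simp only [rInterpolationSpace, rNorm_eq_tailNorm _ hr _ hq]
  exact tailNorm_mono (fun _ => le_rfl) fun x => by
    gcongr
    exact peetreK_lorentzSpace_le hκ f _

/-- `‖f‖` in the `𝓡` Lorentz-Karamata space is controlled by the weak-type interpolation norm. -/
theorem exists_rNorm_rearrangement_le (hq : q ≠ 0) (hr : r ≠ 0) (hκ : 0 < κ) (θ : ℝ) (a b : ℝ → ℝ) :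
    ∃ C : ℝ≥0, ∀ f : Ω →ₘ[μ] 𝕜,
      rNorm ((1 - θ) / κ) r (fun t => b (t ^ (1 / κ))) q (fun t => a (t ^ (1 / κ)))
          (rearrangement f) ≤
        C * (rInterpolationSpace (lorentzSpace μ 𝕜 (ENNReal.ofReal κ) ∞) (lebesgueSpace μ 𝕜 ∞)
          θ r b q a).qnorm f := by
  obtain ⟨c, hc0, hct, hc⟩ := exists_rNorm_rpow_eq q r hq hr a b (1 - θ) hκ
  -- `d` is the loss `e⁻¹` in `mul_rearrangement_le_peetreK`.
  set d : ℝ≥0∞ := ENNReal.ofReal (Real.exp (-1)) with hd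
  have hd0 : d ≠ 0 := by simp [hd, Real.exp_pos]
  have hdt : d ≠ ∞ := ENNReal.ofReal_ne_top
  have hdc0 : d * c ≠ 0 := mul_ne_zero hd0 hc0
  have hdct : d * c ≠ ∞ := ENNReal.mul_ne_top hdt hct
  refine ⟨(d * c)⁻¹.toNNReal, fun f => ?_⟩
  rw [ENNReal.coe_toNNReal (ENNReal.inv_ne_top.2 hdc0)]
  simp only [rInterpolationSpace, rNorm_eq_tailNorm (-θ) hr b hq]
  rw [← ENNReal.mul_le_mul_iff_right hdc0 hdct, ← mul_assoc,
    ENNReal.mul_inv_cancel hdc0 hdct, one_mul, mul_assoc, ← hc,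
    ← tailNorm_const_mul_right hd0 hdt]
  refine tailNorm_mono (fun _ => le_rfl) fun x => ?_
  refine le_trans (le_of_eq ?_) (mul_le_mul_right (mul_rearrangement_le_peetreK hκ f x) _)
  rw [hd, ← mul_assoc, ← mul_assoc, ← ENNReal.ofReal_mul (Real.exp_pos _).le,
    ← ENNReal.ofReal_mul' (Real.exp_pos _).le]
  congr 2
  have : Real.exp (-1) * Real.exp ((1 - θ) * x) = Real.exp (-θ * x) * Real.exp (x - 1) := by
    rw [← Real.exp_add, ← Real.exp_add]
    congr 1
    ring
  linear_combination a (Real.exp x) * this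

/-- The interpolation norm for `(L_κ, L_∞)` is controlled by the norm of the `𝓡` Lorentz-Karamata
space. -/
theorem exists_rInterpolationSpace_lebesgueSpace_qnorm_le (hq : q ≠ 0) (hr : r ≠ 0) (hθ : 0 < θ)
    (hκ : 0 < κ) (ha : IsSlowlyVarying a) (hb : IsSlowlyVarying b) :
    ∃ C : ℝ≥0, ∀ f : Ω →ₘ[μ] 𝕜,
      (rInterpolationSpace (lebesgueSpace μ 𝕜 (ENNReal.ofReal κ)) (lebesgueSpace μ 𝕜 ∞)
          θ r b q a).qnorm f ≤
        C * rNorm ((1 - θ) / κ) r (fun t => b (t ^ (1 / κ))) q (fun t => a (t ^ (1 / κ)))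
          (rearrangement f) := by
  obtain ⟨c, hc0, hct, hc⟩ := exists_rNorm_rpow_eq q r hq hr a b (1 - θ) hκ
  -- With `η = (1 - θ/2)/κ` and `ε = θ/8`, the shift by `k/κ` costs `e^{(1 - 3θ/4)k/κ}` against the
  -- gain `e^{-(1 - θ/2)k/κ}`. The net decay is `e^{-δk}` with `δ = θ/(4κ)`.
  have hδ : 0 < θ / (4 * κ) := by positivity
  have hη : κ * ((1 - θ / 2) / κ) < 1 := by
    rw [mul_div_cancel₀ _ hκ.ne']
    linarith
  set η : ℝ := (1 - θ / 2) / κ with hη'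
  obtain ⟨C₁, h₁⟩ := exists_peetreK_lebesgueSpace_le (μ := μ) (𝕜 := 𝕜) hκ hη
  obtain ⟨C₂, h₂⟩ := exists_tailNorm_iSup_le hq hr hδ
  obtain ⟨C₃, h₃⟩ := exists_tailNorm_dilation_le ha hb q r (1 - θ)
    (show (0 : ℝ) < θ / 8 by positivity)
  -- `C₁ + 1` replaces `C₁` because only a nonzero constant can be pulled out by
  -- `tailNorm_const_mul_right`.
  refine ⟨(C₁ + 1) * (C₂ * (C₃ * c.toNNReal)), fun f => ?_⟩
  set A : ℝ → ℝ≥0∞ := fun x => ENNReal.ofReal (Real.exp ((1 - θ) * x) * a (Real.exp x)) with hA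
  set ψ : ℕ → ℝ → ℝ≥0∞ := fun k x =>
    ENNReal.ofReal (Real.exp (-(η * k))) * (A x * rearrangement f (Real.exp (κ * (x - k / κ))))
    with hψ
  have hC₁0 : ((C₁ + 1 : ℝ≥0) : ℝ≥0∞) ≠ 0 := by simp
  have hrear : ∀ k : ℕ, Antitone fun x : ℝ => rearrangement f (Real.exp (κ * (x - k / κ))) :=
    fun k x y hxy => antitone_rearrangement f (Real.exp_le_exp.2 (by gcongr))
  simp only [rInterpolationSpace, rNorm_eq_tailNorm (-θ) hr b hq]
  calc _ ≤ tailNorm q r (fun y => ENNReal.ofReal (b (Real.exp y)))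
          (fun x => ((C₁ + 1 : ℝ≥0) : ℝ≥0∞) * ⨆ k, ψ k x) := by
        refine tailNorm_mono (fun _ => le_rfl) fun x => ?_
        refine (mul_le_mul_right (h₁ f x) _).trans ?_
        rw [mul_left_comm, ENNReal.mul_iSup]
        refine mul_le_mul' (by simp) (iSup_mono fun k => le_of_eq ?_)
        simp only [hψ, hA]
        rw [← mul_assoc, ← mul_assoc, ← ENNReal.ofReal_mul' (Real.exp_pos _).le,
          ← ENNReal.ofReal_mul (Real.exp_pos _).le, mul_sub, mul_div_cancel₀ _ hκ.ne']
        congr 2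
        have : Real.exp (-θ * x) * Real.exp (x - η * k) =
            Real.exp (-(η * k)) * Real.exp ((1 - θ) * x) := by
          rw [← Real.exp_add, ← Real.exp_add]
          congr 1
          ring
        linear_combination a (Real.exp x) * this
    _ = ((C₁ + 1 : ℝ≥0) : ℝ≥0∞) * tailNorm q r (fun y => ENNReal.ofReal (b (Real.exp y)))
          (fun x => ⨆ k, ψ k x) := tailNorm_const_mul_right hC₁0 ENNReal.coe_ne_top _ _
    _ ≤ ((C₁ + 1 : ℝ≥0) : ℝ≥0∞) * (C₂ * (C₃ * (c * rNorm ((1 - θ) / κ) r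
          (fun t => b (t ^ (1 / κ))) q (fun t => a (t ^ (1 / κ))) (rearrangement f)))) := by
        gcongr
        refine h₂ _ ψ hb.aemeasurable_comp_exp.ennreal_ofReal (fun k => ?_) _ fun k => ?_
        · exact ((aemeasurable_exp_mul_slowlyVarying ha _).mul
            (hrear k).measurable.aemeasurable).const_mul _
        · rw [hψ, tailNorm_const_mul_right (by simp [Real.exp_pos]) ENNReal.ofReal_ne_top]
          refine (mul_le_mul_right (h₃ (fun x => rearrangement f (Real.exp (κ * x))) (k / κ)
            (by positivity)) _).trans ?_
          rw [hc, mul_left_comm, ← mul_assoc (ENNReal.ofReal _) (ENNReal.ofReal _),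
            ← ENNReal.ofReal_mul (Real.exp_pos _).le, ← Real.exp_add, mul_left_comm]
          refine le_of_eq ?_
          congr 3
          rw [hη']
          field_simp
          ring
    _ = _ := by
        rw [ENNReal.coe_mul, ENNReal.coe_mul, ENNReal.coe_mul, ENNReal.coe_toNNReal hct]
        simp only [mul_assoc]

/-- The three spaces coincide. -/
theorem rInterpolationSpace_equal (hq : q ≠ 0) (hr : r ≠ 0) (hθ : 0 < θ) (hκ : 0 < κ)
    (ha : IsSlowlyVarying a) (hb : IsSlowlyVarying b) {p : ℝ≥0∞}
    (hp : (1 / p).toReal = (1 - θ) / κ) :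
    (rInterpolationSpace (lebesgueSpace μ 𝕜 (ENNReal.ofReal κ)) (lebesgueSpace μ 𝕜 ∞)
          θ r b q a).Equal
        (rInterpolationSpace (lorentzSpace μ 𝕜 (ENNReal.ofReal κ) ∞) (lebesgueSpace μ 𝕜 ∞)
          θ r b q a) ∧
      (rInterpolationSpace (lorentzSpace μ 𝕜 (ENNReal.ofReal κ) ∞) (lebesgueSpace μ 𝕜 ∞)
          θ r b q a).Equal
        (rLorentzKaramataSpace μ 𝕜 p r (fun t => b (t ^ (1 / κ))) q
          (fun t => a (t ^ (1 / κ)))) := by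
  set X := rInterpolationSpace (lebesgueSpace μ 𝕜 (ENNReal.ofReal κ)) (lebesgueSpace μ 𝕜 ∞)
    θ r b q a
  set Y := rInterpolationSpace (lorentzSpace μ 𝕜 (ENNReal.ofReal κ) ∞) (lebesgueSpace μ 𝕜 ∞)
    θ r b q a
  set Z := rLorentzKaramataSpace μ 𝕜 p r (fun t => b (t ^ (1 / κ))) q (fun t => a (t ^ (1 / κ)))
    with hZ
  have hX : ∀ f, f ∈ X.carrier ↔ X.qnorm f < ∞ := mem_rInterpolationSpace_iff _ _ hq hr ha hb
  have hY : ∀ f, f ∈ Y.carrier ↔ Y.qnorm f < ∞ := mem_rInterpolationSpace_iff _ _ hq hr ha hb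
  have hZ' : ∀ f, f ∈ Z.carrier ↔ Z.qnorm f < ∞ := fun f => Iff.rfl
  have hZn : ∀ f, Z.qnorm f = rNorm ((1 - θ) / κ) r (fun t => b (t ^ (1 / κ))) q
      (fun t => a (t ^ (1 / κ))) (rearrangement f) := fun f => by
    rw [← hp]
    rfl
  have hYX : ∀ f, Y.qnorm f ≤ X.qnorm f := rInterpolationSpace_lorentzSpace_qnorm_le hq hr hκ
  obtain ⟨C₁, hZY⟩ := exists_rNorm_rearrangement_le (μ := μ) (𝕜 := 𝕜) hq hr hκ θ a b
  obtain ⟨C₂, hXZ⟩ := exists_rInterpolationSpace_lebesgueSpace_qnorm_le (μ := μ) (𝕜 := 𝕜)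
    hq hr hθ hκ ha hb
  simp only [← hZn] at hZY hXZ
  have hXY : ∀ f, X.qnorm f ≤ (C₂ * C₁ : ℝ≥0) * Y.qnorm f := fun f => by
    refine (hXZ f).trans ?_
    rw [ENNReal.coe_mul, mul_assoc]
    gcongr
    exact hZY f
  refine ⟨⟨FunctionSpace.embeds_of_qnorm_le (C := 1) (fun f => (hX f).1) (fun f => (hY f).2)
    fun f => ?_, FunctionSpace.embeds_of_qnorm_le (fun f => (hY f).1) (fun f => (hX f).2) hXY⟩,
    FunctionSpace.embeds_of_qnorm_le (fun f => (hY f).1) (fun f => (hZ' f).2) hZY,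
    FunctionSpace.embeds_of_qnorm_le (fun f => (hZ' f).1) (fun f => (hY f).2)
      fun f => (hYX f).trans (hXZ f)⟩
  simpa using hYX f

theorem rLorentzKaramataSpace_one (p q r : ℝ≥0∞) (b : ℝ → ℝ) :
    rLorentzKaramataSpace μ 𝕜 p r b q (fun _ => 1) = grandLorentzKaramataSpace μ 𝕜 p q r b := by
  simp only [rLorentzKaramataSpace, grandLorentzKaramataSpace, rNorm, weightedNorm, zero_sub,
    mul_one]

end Spaces

/-- Here `b(t^{1/κ})` and `a(t^{1/κ})` are the weights of the Lorentz-Karamata spaces, and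
`p = κ / (1 - θ)` is computed in `[0, ∞]`, so that `p = ∞` if `θ = 1`. -/
theorem theorem5p4 {Ω : Type*} [MeasurableSpace Ω] (μ : Measure Ω) [SigmaFinite μ]
    (hμ : IsNonatomicMeasure μ) (𝕜 : Type*) [RCLike 𝕜]
    (θ : ℝ) (hθ0 : 0 < θ) (hθ1 : θ ≤ 1) (κ : ℝ) (hκ : 0 < κ)
    (p : ℝ≥0∞) (hp : p = ENNReal.ofReal κ / ENNReal.ofReal (1 - θ))
    (q r : ℝ≥0∞) (hq : 0 < q) (hr : 0 < r)
    (a b : ℝ → ℝ) (ha : IsSlowlyVarying a) (hb : IsSlowlyVarying b) :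
    ((rInterpolationSpace (lebesgueSpace μ 𝕜 (ENNReal.ofReal κ)) (lebesgueSpace μ 𝕜 ∞)
          θ r b q a).Equal
        (rInterpolationSpace (lorentzSpace μ 𝕜 (ENNReal.ofReal κ) ∞) (lebesgueSpace μ 𝕜 ∞)
          θ r b q a) ∧
      (rInterpolationSpace (lorentzSpace μ 𝕜 (ENNReal.ofReal κ) ∞) (lebesgueSpace μ 𝕜 ∞)
          θ r b q a).Equal
        (rLorentzKaramataSpace μ 𝕜 p r (fun t => b (t ^ (1 / κ))) q
          (fun t => a (t ^ (1 / κ))))) ∧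
    ((rInterpolationSpace (lebesgueSpace μ 𝕜 (ENNReal.ofReal κ)) (lebesgueSpace μ 𝕜 ∞)
          θ r b q (fun _ => 1)).Equal
        (rInterpolationSpace (lorentzSpace μ 𝕜 (ENNReal.ofReal κ) ∞) (lebesgueSpace μ 𝕜 ∞)
          θ r b q (fun _ => 1)) ∧
      (rInterpolationSpace (lorentzSpace μ 𝕜 (ENNReal.ofReal κ) ∞) (lebesgueSpace μ 𝕜 ∞)
          θ r b q (fun _ => 1)).Equal
        (grandLorentzKaramataSpace μ 𝕜 p q r (fun t => b (t ^ (1 / κ))))) := by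
  have hp' : (1 / p).toReal = (1 - θ) / κ := by
    rw [hp, one_div, ENNReal.inv_div (.inl ENNReal.ofReal_ne_top) (.inr (by simpa using hκ)),
      ENNReal.toReal_div, ENNReal.toReal_ofReal hκ.le, ENNReal.toReal_ofReal (by linarith)]
  refine ⟨rInterpolationSpace_equal hq.ne' hr.ne' hθ0 hκ ha hb hp', ?_⟩
  have h := rInterpolationSpace_equal (μ := μ) (𝕜 := 𝕜) hq.ne' hr.ne' hθ0 hκ
    IsSlowlyVarying.one hb hp'
  rwa [rLorentzKaramataSpace_one] at h
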